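/- Let $\mathbb F_q$ be a finite field with $q$ elements, let $\phi:\mathbb F_q\to\{0,1,\dots,q-1\}$ be a bijection with $\phi(0)=0$, let $d\ge 1$ be an integer, and let $q_1,\dots,q_d\in\mathbb F_q[x]$ be monic, non-constant, pairwise coprime polynomials with degrees $e_1,\dots,e_d$. For each $j\in\{1,\dots,d\}$ let $C^{(j)}=(c^{(j)}_{i,k})_{i\ge1,\,k\ge0}$ be one of the following two matrices over $\mathbb F_q$. (a) (Niederreiter's construction) Write $i=e_js-r$ with $s\ge1$ and $0\le r<e_j$. Then $c^{(j)}_{i,k}$ is the coefficient of $x^{-k-1}$ in the expansion of $x^r/q_j(x)^s$ in $\mathbb F_q((x^{-1}))$. (b) (Column by column construction) Write $x^k=\sum_{s\ge0}b_s(x)\,q_j(x)^s$ with $b_s\in\mathbb F_q[x]$ and $\deg b_s<e_j$. Then $c^{(j)}_{e_js+t+1,\,k}$, for $s\ge0$ and $0\le t<e_j$, is the coefficient of $x^t$ in $b_s$. (In particular, all the matrices may come from (a), or all of them from (b).) Let $(\boldsymbol x_n)_{n\ge0}$, $\boldsymbol x_n=(x_n^{(1)},\dots,x_n^{(d)})\in[0,1)^d$,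 be the digital sequence generated by $C^{(1)},\dots,C^{(d)}$: if $n=\sum_{k\ge0}n_kq^k$ with $n_k\in\{0,\dots,q-1\}$, then $$x_n^{(j)}=\sum_{i\ge1}\frac{\phi\big(y_i^{(j)}\big)}{q^i},\qquad y_i^{(j)}=\sum_{k\ge0}c^{(j)}_{i,k}\,\phi^{-1}(n_k).$$ Then $(\boldsymbol x_n)_{n\ge0}$ does not have Poissonian pair correlations. That is, it is not the case that for every real $s\ge0$ $$\lim_{N\to\infty}\frac1N\,\#\Big\{(n,l): 0\le n,l\le N-1,\ n\ne l,\ \|\boldsymbol x_n-\boldsymbol x_l\|_\infty\le \frac{s}{N^{1/d}}\Big\}=(2s)^d ,$$ where $\|\boldsymbol z\|_\infty=\max_{1\le j\le d}\min_{a\in\mathbb Z}|z^{(j)}-a|$. -/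

import Mathlib

open scoped Polynomial

noncomputable section

/-- Maximum over the coordinates of the distance to the nearest integer
(the norm on `Fin d → ℝ` is the maximum norm). -/
def torusSupNorm {d : ℕ} (x : Fin d → ℝ) : ℝ :=
  ‖fun j => x j - (round (x j) : ℝ)‖

/-- Number of ordered pairs `(n, l)` with `0 ≤ n ≠ l ≤ N - 1` such that
`‖x n - x l‖_∞ ≤ s / N ^ (1 / d)`. -/
def pairCount {d : ℕ} (x : ℕ → Fin d → ℝ) (s : ℝ) (N : ℕ) : ℕ :=
  Set.ncard {p : ℕ × ℕ | p.1 < N ∧ p.2 < N ∧ p.1 ≠ p.2 ∧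
    torusSupNorm (x p.1 - x p.2) ≤ s / (N : ℝ) ^ (1 / (d : ℝ))}

/-- Poissonian pair correlations of a `d`-dimensional sequence. -/
def HasPoissonianPairCorrelations {d : ℕ} (x : ℕ → Fin d → ℝ) : Prop :=
  ∀ s : ℝ, 0 ≤ s →
    Filter.Tendsto (fun N : ℕ => (pairCount x s N : ℝ) / (N : ℝ)) Filter.atTop
      (nhds ((2 * s) ^ d))

section Digital

variable {F : Type*} [Field F] [Fintype F]

/-- The `k`-th digit of `n` in base `q = #F`, as an element of `{0, …, q - 1}`. -/
def baseDigit (F : Type*) [Field F] [Fintype F] (n k : ℕ) : Fin (Fintype.card F) :=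
  ⟨n / Fintype.card F ^ k % Fintype.card F, Nat.mod_lt _ Fintype.card_pos⟩

/-- The entries of `C · (φ⁻¹(n₀), φ⁻¹(n₁), …)ᵀ`. Rows are indexed from `0` here, so that row `i`
is the `(i + 1)`-st row. When `φ 0 = 0`, only finitely many summands are nonzero. -/
def digitalVector (φ : F ≃ Fin (Fintype.card F)) (C : Matrix ℕ ℕ F) (n i : ℕ) : F :=
  ∑ᶠ k : ℕ, C i k * φ.symm (baseDigit F n k)

/-- The digital sequence over `F` with digit bijection `φ` and generating matrices `C`. -/
def digitalSequence {d : ℕ} (φ : F ≃ Fin (Fintype.card F)) (C : Fin d → Matrix ℕ ℕ F)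
    (n : ℕ) (j : Fin d) : ℝ :=
  ∑' i : ℕ, ((φ (digitalVector φ (C j) n i) : ℕ) : ℝ) / (Fintype.card F : ℝ) ^ (i + 1)

end Digital

section Matrices

variable {F : Type*} [Field F]

/-- The embedding of `F[x]` into `F((x⁻¹))`. The variable of `LaurentSeries F` plays the role
of `x⁻¹`, so `x` is sent to the monomial of exponent `-1`. -/
def polyAtInfinity : F[X] →ₐ[F] LaurentSeries F :=
  Polynomial.aeval (HahnSeries.single (-1 : ℤ) (1 : F))

/-- The coefficient of `x ^ (-k - 1)` in the expansion of `x ^ r / Q ^ s` in `F((x⁻¹))`. -/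
def laurentDigit (Q : F[X]) (s r k : ℕ) : F :=
  (polyAtInfinity (Polynomial.X ^ r : F[X]) / polyAtInfinity (Q ^ s)).coeff ((k : ℤ) + 1)

/-- The Niederreiter matrix of `Q`. With `e = deg Q`, the row with one-based index `i + 1` is
given by `x ^ r / Q ^ s` with `i + 1 = e * s - r`, `s ≥ 1` and `0 ≤ r < e`. -/
def niederreiterMatrix (Q : F[X]) : Matrix ℕ ℕ F := fun i k =>
  laurentDigit Q (i / Q.natDegree + 1) (Q.natDegree - 1 - i % Q.natDegree) k

/-- The `Q`-adic digit `b_s` of `f`, by repeated division with remainder: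
`f = ∑ b_s * Q ^ s` with `deg b_s < deg Q`. -/
def adicDigit (Q f : F[X]) (s : ℕ) : F[X] :=
  ((fun g : F[X] => g /ₘ Q)^[s] f) %ₘ Q

/-- The column by column matrix of `Q`. With `e = deg Q`, the entry in the row with one-based
index `e * s + t + 1` (`0 ≤ t < e`) and in column `k` is the coefficient of `x ^ t` in the digit
`b_s` of `x ^ k`. -/
def columnMatrix (Q : F[X]) : Matrix ℕ ℕ F := fun i k =>
  (adicDigit Q (Polynomial.X ^ k) (i / Q.natDegree)).coeff (i % Q.natDegree)

end Matrices

end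

/-! ### Coefficient functionals and the common polynomial multiple -/

section PolynomialFacts

variable {F : Type*} [Field F]

/-! The Poissonian limit `(2 * s) ^ d` is continuous in `s`. For arbitrarily large `N`, however, a
proportion at least `q ^ (-d)` of the normalized distances lies in any prescribed window around `s =
φ 1`.

Such pairs come from one polynomial `P`, of degree `d * A`, that looks like `Q j ^ S` to high `Q
j`-adic precision for all `j` at once, with `deg (Q j) * S = A` (`exists_monic_eq_pow_mul_one_add`).
Under either construction, each matrix sends the coefficient vector `u` of `P` to the unit vector at
zero-based row `A`, up to row `A + T` (the two `_row_pow_mul_one_add` lemmas). If row `A` of every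
matrix kills `v`, the points with digit vectors `u + v` and `v` agree in all digits before `A + T`
except digit `A`, which is `φ 1` against `0`. With `N = q ^ (d * (A + 1))` their normalized distance
is `φ 1` up to `q ^ (1 - T)`. The `d` linear conditions on `v` leave at least `N / q ^ d` choices.
-/

theorem Polynomial.sum_map_X_pow_mul_coeff (ℓ : F[X] →ₗ[F] F) (P : F[X]) {M : ℕ}
    (hM : P.natDegree < M) :
    ∑ k ∈ Finset.range M, ℓ (Polynomial.X ^ k) * P.coeff k = ℓ P := by
  conv_rhs => rw [P.as_sum_range' M hM]
  rw [map_sum]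
  refine Finset.sum_congr rfl fun k _ => ?_
  rw [← mul_one (P.coeff k), ← smul_eq_mul (P.coeff k) (1 : F), ← Polynomial.smul_monomial,
    map_smul, Polynomial.monomial_one_right_eq_X_pow, smul_eq_mul, smul_eq_mul, mul_one, mul_comm]

/-- `U` is a unit of the finite ring `F[X] ⧸ (V)`, hence has finite order. -/
theorem Polynomial.Monic.exists_dvd_pow_sub_one [Finite F] {U V : F[X]} (hV : V.Monic)
    (h : IsCoprime U V) : ∃ R : ℕ, 0 < R ∧ V ∣ U ^ R - 1 := by
  have := hV.finite_quotient
  have : Finite (F[X] ⧸ Ideal.span {V}) := Module.finite_of_finite F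
  have hu : IsUnit (Ideal.Quotient.mk (Ideal.span {V}) U) := by
    obtain ⟨a, b, hab⟩ := h
    refine IsUnit.of_mul_eq_one (Ideal.Quotient.mk _ a) ?_
    rw [← map_mul, ← map_one (Ideal.Quotient.mk (Ideal.span {V})), Ideal.Quotient.mk_eq_mk_iff_sub_mem,
      Ideal.mem_span_singleton]
    exact ⟨-b, by linear_combination hab⟩
  obtain ⟨u, hu⟩ := hu
  obtain ⟨R, hR, hR1⟩ := isOfFinOrder_iff_pow_eq_one.1 (isOfFinOrder_of_finite u)
  refine ⟨R, hR, ?_⟩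
  rw [← Ideal.mem_span_singleton, ← Ideal.Quotient.mk_eq_mk_iff_sub_mem, map_pow, ← hu,
    ← Units.val_pow_eq_pow_val, hR1, map_one, Units.val_one]

/-- A product of powers of the `Q j` of one common degree `A` which is congruent to
`Q j ^ S` modulo `Q j ^ (S + T)` for every `j`. -/
theorem exists_monic_eq_pow_mul_one_add [Finite F] {d : ℕ} (Q : Fin d → F[X])
    (hmonic : ∀ j, (Q j).Monic) (hdeg : ∀ j, 0 < (Q j).natDegree)
    (hcop : ∀ i j, i ≠ j → IsCoprime (Q i) (Q j)) (T : ℕ) :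
    ∃ (A : ℕ) (P : F[X]), T ≤ A ∧ P.Monic ∧ P.natDegree = d * A ∧
      ∀ j, ∃ (S : ℕ) (w : F[X]), (Q j).natDegree * S = A ∧ P = Q j ^ S * (1 + Q j ^ T * w) := by
  -- These exponents give all the `Q k ^ a k` the same degree.
  let a : Fin d → ℕ := fun k => ∏ i ∈ Finset.univ.erase k, (Q i).natDegree
  have ha : ∀ k, (Q k).natDegree * a k = ∏ i, (Q i).natDegree := fun k =>
    Finset.mul_prod_erase _ (fun i => (Q i).natDegree) (Finset.mem_univ k)
  let U : Fin d → F[X] := fun j => ∏ k ∈ Finset.univ.erase j, Q k ^ a k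
  have hU : ∀ j, ∃ R : ℕ, 0 < R ∧ Q j ^ T ∣ U j ^ R - 1 := fun j =>
    ((hmonic j).pow T).exists_dvd_pow_sub_one <| IsCoprime.prod_left fun k hk =>
      (hcop k j (Finset.ne_of_mem_erase hk)).pow
  choose R hR hdvd using hU
  -- A multiple of every `R j`, so that each `U j ^ N` is 1 modulo `Q j ^ T`; the factor `T` ensures
  -- `T ≤ A`.
  let N : ℕ := T * ∏ j, R j
  have hN : T ≤ N := Nat.le_mul_of_pos_right _ (Finset.prod_pos fun j _ => hR j)
  refine ⟨(∏ i, (Q i).natDegree) * N, (∏ k, Q k ^ a k) ^ N, ?_, ?_, ?_, fun j => ?_⟩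
  · exact hN.trans (Nat.le_mul_of_pos_left _ (Finset.prod_pos fun j _ => hdeg j))
  · exact (Polynomial.monic_prod_of_monic _ _ fun k _ => (hmonic k).pow _).pow _
  · rw [Polynomial.natDegree_pow, Polynomial.natDegree_prod_of_monic _ _ fun k _ => (hmonic k).pow _]
    simp only [Polynomial.natDegree_pow, fun k => mul_comm (a k), ha, Finset.sum_const,
      Finset.card_univ, Fintype.card_fin, smul_eq_mul]
    ring
  · have hRN : R j ∣ N := (Finset.dvd_prod_of_mem R (Finset.mem_univ j)).mul_left T
    obtain ⟨c, hc⟩ := hRN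
    obtain ⟨w, hw⟩ := (hdvd j).trans (sub_one_dvd_pow_sub_one (U j ^ R j) c)
    refine ⟨a j * N, w, by rw [← mul_assoc, ha], ?_⟩
    have hprod : Q j ^ a j * U j = ∏ k, Q k ^ a k :=
      Finset.mul_prod_erase _ (fun k => Q k ^ a k) (Finset.mem_univ j)
    rw [← hw, ← pow_mul, ← hc, add_sub_cancel, ← hprod, mul_pow, pow_mul (Q j) (a j) N]

end PolynomialFacts

/-! ### Column by column matrices: `Q`-adic digits -/

section ColumnMatrix

variable {F : Type*} [Field F]

/-- The quotient by a monic polynomial as a linear map. -/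
noncomputable def Polynomial.divByMonicHom {Q : F[X]} (hQ : Q.Monic) : F[X] →ₗ[F] F[X] where
  toFun f := f /ₘ Q
  map_add' f g := by
    refine (Polynomial.div_modByMonic_unique (f /ₘ Q + g /ₘ Q) ((f + g) %ₘ Q) hQ
      ⟨?_, Polynomial.degree_modByMonic_lt _ hQ⟩).1
    rw [Polynomial.add_modByMonic]
    linear_combination Polynomial.modByMonic_add_div f Q + Polynomial.modByMonic_add_div g Q
  map_smul' c f := by
    refine (Polynomial.div_modByMonic_unique (c • (f /ₘ Q)) ((c • f) %ₘ Q) hQ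
      ⟨?_, Polynomial.degree_modByMonic_lt _ hQ⟩).1
    rw [Polynomial.smul_modByMonic, mul_smul_comm, ← smul_add, Polynomial.modByMonic_add_div]

theorem iterate_divByMonic_pow_mul {Q : F[X]} (hQ : Q.Monic) (s : ℕ) (f : F[X]) :
    (fun g : F[X] => g /ₘ Q)^[s] (Q ^ s * f) = f := by
  induction s with
  | zero => simp
  | succ s ih =>
    rw [Function.iterate_succ_apply, pow_succ', mul_assoc,
      Polynomial.mul_divByMonic_cancel_left _ hQ, ih]

/-- The polynomial is `Q ^ S` plus a multiple of `Q ^ (S + T)`, which cannot affect the digits below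
`S + T`. -/
theorem adicDigit_pow_mul_one_add {Q : F[X]} (hQ : Q.Monic) (hdeg : 0 < Q.natDegree) (w : F[X])
    {S T s : ℕ} (hT : 0 < T) (hs : s < S + T) :
    adicDigit Q (Q ^ S * (1 + Q ^ T * w)) s = if s = S then 1 else 0 := by
  have h1 : (1 : F[X]).degree < Q.degree := by
    rw [Polynomial.degree_one]
    exact Polynomial.natDegree_pos_iff_degree_pos.1 hdeg
  have hmod : ∀ {n : ℕ} (_ : 0 < n) (f : F[X]), (Q ^ n * f) %ₘ Q = 0 := fun {n} hn f =>
    (Polynomial.modByMonic_eq_zero_iff_dvd hQ).2 ((dvd_pow_self Q hn.ne').mul_right f)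
  have hmod1 : (1 + Q ^ T * w) %ₘ Q = 1 := by
    rw [Polynomial.add_modByMonic, hmod hT, add_zero, (Polynomial.modByMonic_eq_self_iff hQ).2 h1]
  have hdiv1 : (1 + Q ^ T * w) /ₘ Q = Q ^ (T - 1) * w := by
    have h := Polynomial.modByMonic_add_div (1 + Q ^ T * w) Q
    rw [hmod1] at h
    apply mul_left_cancel₀ hQ.ne_zero
    rw [add_left_cancel h, ← mul_assoc, ← pow_succ', Nat.sub_add_cancel hT]
  unfold adicDigit
  rcases lt_trichotomy s S with h | h | h
  · obtain ⟨n, rfl⟩ := Nat.exists_eq_add_of_lt h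
    rw [if_neg h.ne, add_assoc, pow_add, mul_assoc, iterate_divByMonic_pow_mul hQ, hmod (by omega)]
  · subst h
    rw [if_pos rfl, iterate_divByMonic_pow_mul hQ, hmod1]
  · obtain ⟨n, rfl⟩ := Nat.exists_eq_add_of_lt h
    obtain ⟨m, rfl⟩ := Nat.exists_eq_add_of_lt (show n + 1 < T + 0 + 0 by omega)
    rw [if_neg h.ne', add_assoc, add_comm S, Function.iterate_add_apply,
      iterate_divByMonic_pow_mul hQ, Function.iterate_succ_apply]
    simp only [hdiv1]
    rw [show n + 1 + m + 1 - 1 = n + (m + 1) by omega, pow_add, mul_assoc,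
      iterate_divByMonic_pow_mul hQ, hmod (by omega)]

/-- Digit extraction is linear, so its values on the powers of `X` determine it. -/
theorem columnMatrix_row_apply {Q : F[X]} (hQ : Q.Monic) (P : F[X]) (i : ℕ) {M : ℕ}
    (hM : P.natDegree < M) :
    ∑ k ∈ Finset.range M, columnMatrix Q i k * P.coeff k =
      (adicDigit Q P (i / Q.natDegree)).coeff (i % Q.natDegree) := by
  let ℓ : F[X] →ₗ[F] F := Polynomial.lcoeff F (i % Q.natDegree) ∘ₗ Polynomial.modByMonicHom Q ∘ₗ
    (Polynomial.divByMonicHom hQ) ^ (i / Q.natDegree)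
  have hℓ : ∀ f, ℓ f = (adicDigit Q f (i / Q.natDegree)).coeff (i % Q.natDegree) := fun f => by
    simp only [ℓ, LinearMap.comp_apply, Module.End.pow_apply]
    rfl
  rw [← hℓ, ← Polynomial.sum_map_X_pow_mul_coeff ℓ P hM]
  simp only [hℓ]
  rfl

theorem columnMatrix_row_pow_mul_one_add {Q : F[X]} (hQ : Q.Monic) (hdeg : 0 < Q.natDegree)
    (w : F[X]) {S T i M : ℕ} (hT : 0 < T) (hi : i < Q.natDegree * (S + T))
    (hM : (Q ^ S * (1 + Q ^ T * w)).natDegree < M) :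
    ∑ k ∈ Finset.range M, columnMatrix Q i k * (Q ^ S * (1 + Q ^ T * w)).coeff k =
      if i = Q.natDegree * S then 1 else 0 := by
  rw [columnMatrix_row_apply hQ _ _ hM,
    adicDigit_pow_mul_one_add hQ hdeg w hT (Nat.div_lt_of_lt_mul hi)]
  have h := Nat.div_add_mod i Q.natDegree
  by_cases hS : i / Q.natDegree = S
  · rw [if_pos hS, Polynomial.coeff_one]
    rw [hS] at h
    congr 1
    apply propext
    omega
  · rw [if_neg hS, Polynomial.coeff_zero, if_neg]
    rintro rfl
    exact hS (Nat.mul_div_cancel_left _ hdeg)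

end ColumnMatrix

/-! ### Niederreiter matrices: expansions at infinity -/

section NiederreiterMatrix

variable {F : Type*} [Field F]

theorem polyAtInfinity_C (c : F) : polyAtInfinity (Polynomial.C c) = HahnSeries.C c := by
  rw [polyAtInfinity, Polynomial.aeval_C, HahnSeries.algebraMap_apply', ← HahnSeries.ofPowerSeries_C]
  rfl

theorem polyAtInfinity_smul (c : F) (f : F[X]) :
    polyAtInfinity (c • f) = c • polyAtInfinity f := by
  rw [Polynomial.smul_eq_C_mul, map_mul, polyAtInfinity_C, HahnSeries.C_mul_eq_smul]

theorem polyAtInfinity_X_pow (k : ℕ) :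
    polyAtInfinity (Polynomial.X ^ k : F[X]) = HahnSeries.single (-(k : ℤ)) (1 : F) := by
  simp [polyAtInfinity, HahnSeries.single_pow]

theorem coeff_polyAtInfinity (f : F[X]) (n : ℕ) :
    (polyAtInfinity f).coeff (-(n : ℤ)) = f.coeff n := by
  induction f using Polynomial.induction_on' with
  | add f g hf hg => simp [hf, hg]
  | monomial k a =>
    rw [← mul_one a, ← smul_eq_mul, ← Polynomial.smul_monomial, polyAtInfinity_smul,
      Polynomial.monomial_one_right_eq_X_pow, polyAtInfinity_X_pow, HahnSeries.coeff_smul,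
      HahnSeries.coeff_single]
    simp [Polynomial.coeff_X_pow]

theorem coeff_polyAtInfinity_of_pos (f : F[X]) {z : ℤ} (hz : 0 < z) :
    (polyAtInfinity f).coeff z = 0 := by
  induction f using Polynomial.induction_on' with
  | add f g hf hg => simp [hf, hg]
  | monomial k a =>
    rw [← mul_one a, ← smul_eq_mul, ← Polynomial.smul_monomial, polyAtInfinity_smul,
      Polynomial.monomial_one_right_eq_X_pow, polyAtInfinity_X_pow, HahnSeries.coeff_smul,
      HahnSeries.coeff_single_of_ne (by omega), smul_zero]

theorem polyAtInfinity_ne_zero {f : F[X]} (hf : f ≠ 0) : polyAtInfinity f ≠ 0 := fun h => by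
  have := coeff_polyAtInfinity f f.natDegree
  rw [h, HahnSeries.coeff_zero] at this
  exact hf (Polynomial.leadingCoeff_eq_zero.1 this.symm)

theorem order_polyAtInfinity {f : F[X]} (hf : f ≠ 0) :
    (polyAtInfinity f).order = -(f.natDegree : ℤ) := by
  apply le_antisymm
  · apply HahnSeries.order_le_of_coeff_ne_zero
    rw [coeff_polyAtInfinity]
    exact Polynomial.leadingCoeff_ne_zero.2 hf
  · by_contra! h
    have hne := mt HahnSeries.coeff_order_eq_zero.1 (polyAtInfinity_ne_zero hf)
    obtain ⟨n, hn⟩ := Int.eq_ofNat_of_zero_le (show 0 ≤ -(polyAtInfinity f).order by omega)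
    rw [show (polyAtInfinity f).order = -(n : ℤ) by omega, coeff_polyAtInfinity] at hne
    exact hne (Polynomial.coeff_eq_zero_of_natDegree_lt (by omega))

theorem leadingCoeff_polyAtInfinity (f : F[X]) :
    (polyAtInfinity f).leadingCoeff = f.leadingCoeff := by
  rcases eq_or_ne f 0 with rfl | hf
  · simp
  · rw [HahnSeries.leadingCoeff_eq, order_polyAtInfinity hf, coeff_polyAtInfinity,
      Polynomial.leadingCoeff]

/-- Orders and leading coefficients are multiplicative: the quotient starts with coefficient 1 at
exponent `deg g - deg f`. -/
theorem coeff_one_polyAtInfinity_div {f g : F[X]} (hf : f.Monic) (hg : g.Monic)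
    (h : f.natDegree < g.natDegree) :
    (polyAtInfinity f / polyAtInfinity g).coeff 1 =
      if g.natDegree = f.natDegree + 1 then 1 else 0 := by
  have hf0 := polyAtInfinity_ne_zero hf.ne_zero
  have hg0 := polyAtInfinity_ne_zero hg.ne_zero
  set y := polyAtInfinity f / polyAtInfinity g
  have hy0 : y ≠ 0 := div_ne_zero hf0 hg0
  have hmul : y * polyAtInfinity g = polyAtInfinity f := div_mul_cancel₀ _ hg0
  have hord : y.order = (g.natDegree : ℤ) - f.natDegree := by
    have := HahnSeries.order_mul hy0 hg0
    rw [hmul, order_polyAtInfinity hf.ne_zero, order_polyAtInfinity hg.ne_zero] at this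
    omega
  have hlead : y.leadingCoeff = 1 := by
    have := HahnSeries.leadingCoeff_mul y (polyAtInfinity g)
    rw [hmul, leadingCoeff_polyAtInfinity, leadingCoeff_polyAtInfinity, hf.leadingCoeff,
      hg.leadingCoeff, mul_one] at this
    exact this.symm
  split_ifs with h1
  · rw [← hlead, HahnSeries.leadingCoeff_eq, hord]
    congr 1
    omega
  · exact HahnSeries.coeff_eq_zero_of_lt_order (by omega)

/-- Multiplication by `x ^ k` moves the coefficient of `x ^ (-k - 1)` to that of `x ^ (-1)`. -/
theorem niederreiterMatrix_row_apply (Q P : F[X]) (i : ℕ) {M : ℕ} (hM : P.natDegree < M) :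
    ∑ k ∈ Finset.range M, niederreiterMatrix Q i k * P.coeff k =
      (polyAtInfinity P * (polyAtInfinity (Polynomial.X ^ (Q.natDegree - 1 - i % Q.natDegree)) /
        polyAtInfinity (Q ^ (i / Q.natDegree + 1)))).coeff 1 := by
  set g := polyAtInfinity (Polynomial.X ^ (Q.natDegree - 1 - i % Q.natDegree)) /
        polyAtInfinity (Q ^ (i / Q.natDegree + 1))
  let ℓ : F[X] →ₗ[F] F :=
    { toFun := fun f => (polyAtInfinity f * g).coeff 1
      map_add' := fun f h => by simp [add_mul]
      map_smul' := fun c f => by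
        rw [Polynomial.smul_eq_C_mul, map_mul, polyAtInfinity_C, mul_assoc, HahnSeries.C_mul_eq_smul,
          HahnSeries.coeff_smul, RingHom.id_apply] }
  rw [show (polyAtInfinity P * g).coeff 1 = ℓ P from rfl,
    ← Polynomial.sum_map_X_pow_mul_coeff ℓ P hM]
  refine Finset.sum_congr rfl fun k _ => ?_
  congr 1
  change g.coeff ((k : ℤ) + 1) = (polyAtInfinity (Polynomial.X ^ k) * g).coeff 1
  rw [polyAtInfinity_X_pow, HahnSeries.coeff_single_mul, one_mul]
  congr 1
  omega

theorem niederreiterMatrix_row_pow_mul_one_add {Q : F[X]} (hQ : Q.Monic) (hdeg : 0 < Q.natDegree)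
    (w : F[X]) {S T i M : ℕ} (hi : i < Q.natDegree * (S + T))
    (hM : (Q ^ S * (1 + Q ^ T * w)).natDegree < M) :
    ∑ k ∈ Finset.range M, niederreiterMatrix Q i k * (Q ^ S * (1 + Q ^ T * w)).coeff k =
      if i = Q.natDegree * S then 1 else 0 := by
  rw [niederreiterMatrix_row_apply Q _ i hM]
  have hs : i / Q.natDegree < S + T := Nat.div_lt_of_lt_mul hi
  have hmod := Nat.mod_lt i hdeg
  have hi' := Nat.div_add_mod i Q.natDegree
  obtain ⟨s, hs_def⟩ : ∃ s, s = i / Q.natDegree := ⟨_, rfl⟩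
  rw [← hs_def] at hs hi' ⊢
  set r := Q.natDegree - 1 - i % Q.natDegree with hr
  -- The denominator is `Q ^ (s + 1)`. For `s < S` it divides out and leaves a polynomial.
  -- Otherwise, modulo polynomials, `X ^ r / Q ^ (s - S + 1)` remains; since `r < deg Q`, it has an
  -- `x ^ (-1)` term only for `s = S` and `r = deg Q - 1`.
  rcases lt_or_ge s S with h | h
  · obtain ⟨n, rfl⟩ := Nat.exists_eq_add_of_lt h
    have : polyAtInfinity (Q ^ (s + n + 1) * (1 + Q ^ T * w)) *
        (polyAtInfinity (Polynomial.X ^ r) / polyAtInfinity (Q ^ (s + 1))) =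
        polyAtInfinity (Q ^ n * (1 + Q ^ T * w) * Polynomial.X ^ r) := by
      rw [mul_div_assoc', div_eq_iff (polyAtInfinity_ne_zero (pow_ne_zero _ hQ.ne_zero)),
        ← map_mul, ← map_mul]
      congr 1
      ring
    rw [this, coeff_polyAtInfinity_of_pos _ one_pos, if_neg]
    intro h
    rw [h, Nat.mul_div_cancel_left _ hdeg] at hs_def
    omega
  · obtain ⟨n, rfl⟩ := Nat.exists_eq_add_of_le h
    obtain ⟨m, rfl⟩ := Nat.exists_eq_add_of_le (show n + 1 ≤ T by omega)
    have : polyAtInfinity (Q ^ S * (1 + Q ^ (n + 1 + m) * w)) *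
        (polyAtInfinity (Polynomial.X ^ r) / polyAtInfinity (Q ^ (S + n + 1))) =
        polyAtInfinity (Polynomial.X ^ r) / polyAtInfinity (Q ^ (n + 1)) +
          polyAtInfinity (Q ^ m * w * Polynomial.X ^ r) := by
      have h1 := polyAtInfinity_ne_zero (pow_ne_zero (n + 1) hQ.ne_zero)
      rw [mul_div_assoc', div_eq_iff (polyAtInfinity_ne_zero (pow_ne_zero _ hQ.ne_zero)),
        add_assoc S, pow_add Q S, map_mul polyAtInfinity (Q ^ S) (Q ^ (n + 1)), add_mul,
        mul_left_comm (_ / _), div_mul_cancel₀ _ h1]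
      simp only [← map_mul, ← map_add]
      congr 1
      ring
    have hle : Q.natDegree ≤ (n + 1) * Q.natDegree := Nat.le_mul_of_pos_left _ n.succ_pos
    rw [this, HahnSeries.coeff_add, coeff_polyAtInfinity_of_pos _ one_pos, add_zero,
      coeff_one_polyAtInfinity_div (Polynomial.monic_X_pow r) (hQ.pow _)]
    · rw [hQ.natDegree_pow, Polynomial.natDegree_X_pow]
      congr 1
      apply propext
      rcases n with - | n
      · rw [add_zero] at hi'
        omega
      · have h1 : (n + 1 + 1) * Q.natDegree = Q.natDegree * n + Q.natDegree + Q.natDegree := by ring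
        have h2 : Q.natDegree * (S + (n + 1)) = Q.natDegree * S + Q.natDegree * n + Q.natDegree := by
          ring
        rw [h2] at hi'
        constructor <;> intro h <;> omega
    · rw [hQ.natDegree_pow, Polynomial.natDegree_X_pow]
      omega

end NiederreiterMatrix

/-! ### Jumps of the pair counting function -/

section PairCount

theorem finite_setOf_pair_lt (N : ℕ) (p : ℕ × ℕ → Prop) :
    {a : ℕ × ℕ | a.1 < N ∧ a.2 < N ∧ p a}.Finite :=
  ((Set.finite_Iio N).prod (Set.finite_Iio N)).subset fun _ ha => ⟨ha.1, ha.2.1⟩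

theorem pairCount_add_card_le {d : ℕ} {x : ℕ → Fin d → ℝ} {s₁ s₂ : ℝ} {N : ℕ} (hs : s₁ ≤ s₂)
    {ι : Type*} [Finite ι] (f : ι → ℕ × ℕ) (hf : Function.Injective f)
    (hlt : ∀ i, (f i).1 < N ∧ (f i).2 < N ∧ (f i).1 ≠ (f i).2)
    (h₁ : ∀ i, s₁ / (N : ℝ) ^ (1 / (d : ℝ)) < torusSupNorm (x (f i).1 - x (f i).2))
    (h₂ : ∀ i, torusSupNorm (x (f i).1 - x (f i).2) ≤ s₂ / (N : ℝ) ^ (1 / (d : ℝ))) :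
    pairCount x s₁ N + Nat.card ι ≤ pairCount x s₂ N := by
  have hdisj : Disjoint {p : ℕ × ℕ | p.1 < N ∧ p.2 < N ∧ p.1 ≠ p.2 ∧
      torusSupNorm (x p.1 - x p.2) ≤ s₁ / (N : ℝ) ^ (1 / (d : ℝ))} (Set.range f) := by
    rw [Set.disjoint_left]
    rintro _ hp ⟨i, rfl⟩
    exact (h₁ i).not_ge hp.2.2.2
  unfold pairCount
  rw [← Set.ncard_univ ι, ← Set.ncard_image_of_injective _ hf, Set.image_univ,
    ← Set.ncard_union_eq hdisj (finite_setOf_pair_lt N _) (Set.finite_range f)]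
  refine Set.ncard_le_ncard ?_ (finite_setOf_pair_lt N _)
  rintro p (hp | ⟨i, rfl⟩)
  · exact ⟨hp.1, hp.2.1, hp.2.2.1, hp.2.2.2.trans (by gcongr)⟩
  · exact ⟨(hlt i).1, (hlt i).2.1, (hlt i).2.2, h₂ i⟩

/-- If, for arbitrarily large `N`, a positive proportion of pairs has normalized distance close to
a fixed value, then the limiting pair correlation function would have a jump. -/
theorem not_hasPoissonianPairCorrelations_of_frequently {d : ℕ} {x : ℕ → Fin d → ℝ} {s c : ℝ}
    (hs : 0 < s) (hc : 0 < c)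
    (h : ∀ ε > 0, ∃ᶠ N : ℕ in Filter.atTop,
      (pairCount x (s - ε) N : ℝ) / N + c ≤ (pairCount x (s + ε) N : ℝ) / N) :
    ¬ HasPoissonianPairCorrelations x := by
  intro hP
  have hlim : Filter.Tendsto (fun ε : ℝ => (2 * (s + ε)) ^ d - (2 * (s - ε)) ^ d)
      (nhdsWithin 0 (Set.Ioi 0)) (nhds 0) := by
    refine Filter.Tendsto.mono_left ?_ nhdsWithin_le_nhds
    have : Continuous fun ε : ℝ => (2 * (s + ε)) ^ d - (2 * (s - ε)) ^ d := by fun_prop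
    simpa using this.tendsto 0
  have hsmall : ∀ᶠ ε : ℝ in nhdsWithin 0 (Set.Ioi 0), ε < s :=
    (eventually_lt_nhds hs).filter_mono nhdsWithin_le_nhds
  obtain ⟨ε, hεc, hεs, hε⟩ := ((hlim.eventually (eventually_lt_nhds hc)).and
    (hsmall.and self_mem_nhdsWithin)).exists
  have hε : 0 < ε := hε
  have hdiff := (hP (s + ε) (by linarith)).sub (hP (s - ε) (by linarith))
  refine absurd hεc (not_lt.2 (ge_of_tendsto_of_frequently hdiff ?_))
  exact (h ε hε).mono fun N hN => by linarith

end PairCount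

/-! ### Changing a single digit, and the torus norm -/

theorem Real.abs_ofDigits_sub_ofDigits_sub_le {b : ℕ} {x y : ℕ → Fin b} {m n : ℕ} (hmn : m < n)
    (hxy : ∀ i < n, i ≠ m → x i = y i) :
    |Real.ofDigits x - Real.ofDigits y - (((x m : ℕ) : ℝ) - (y m : ℕ)) / (b : ℝ) ^ (m + 1)| ≤
      ((b : ℝ) ^ n)⁻¹ := by
  -- Replacing digit `m` of `y` by that of `x` gives a sequence that agrees with `x` in the first
  -- `n` digits.
  have hz : ∀ i < n, x i = Function.update y m (x m) i := fun i hi => by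
    rcases eq_or_ne i m with rfl | him
    · simp
    · rw [Function.update_of_ne him, hxy i hi him]
  have hzy : Real.ofDigits (Function.update y m (x m)) =
      Real.ofDigits y + (((x m : ℕ) : ℝ) - (y m : ℕ)) / (b : ℝ) ^ (m + 1) := by
    have htail : (fun i => Function.update y m (x m) (i + (m + 1))) = fun i => y (i + (m + 1)) :=
      funext fun i => Function.update_of_ne (by omega) _ _
    have hsum : ∑ i ∈ Finset.range m, Real.ofDigitsTerm (Function.update y m (x m)) i =
        ∑ i ∈ Finset.range m, Real.ofDigitsTerm y i :=
      Finset.sum_congr rfl fun i hi => by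
        rw [Real.ofDigitsTerm, Real.ofDigitsTerm,
          Function.update_of_ne (Finset.mem_range.1 hi).ne]
    rw [Real.ofDigits_eq_sum_add_ofDigits _ (m + 1), htail, Finset.sum_range_succ, hsum,
      Real.ofDigits_eq_sum_add_ofDigits y (m + 1), Finset.sum_range_succ]
    simp only [Real.ofDigitsTerm, Function.update_self]
    ring
  have h := Real.abs_ofDigits_sub_ofDigits_le hz
  rwa [hzy, ← sub_sub] at h

theorem torusSupNorm_mem_Icc {d : ℕ} (hd : 1 ≤ d) {z : Fin d → ℝ} {a b : ℝ} (ha : 0 ≤ a)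
    (hb : b < 1 / 2) (hz : ∀ j, z j ∈ Set.Icc a b) : torusSupNorm z ∈ Set.Icc a b := by
  have hround : ∀ j, z j - (round (z j) : ℝ) = z j := fun j => by
    rw [round_eq_zero_iff.2 ⟨by linarith [(hz j).1], by linarith [(hz j).2]⟩, Int.cast_zero,
      sub_zero]
  have hnorm : ∀ j, ‖z j‖ = z j := fun j => by
    rw [Real.norm_eq_abs, abs_of_nonneg (ha.trans (hz j).1)]
  unfold torusSupNorm
  simp only [hround]
  constructor
  · exact (hz ⟨0, hd⟩).1.trans ((hnorm ⟨0, hd⟩).symm.trans_le (norm_le_pi_norm z ⟨0, hd⟩))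
  · refine (pi_norm_le_iff_of_nonneg (ha.trans ((hz ⟨0, hd⟩).1.trans (hz ⟨0, hd⟩).2))).2 fun j => ?_
    exact (hnorm j).trans_le (hz j).2

/-! ### Digit vectors and digital sequences -/

section Digital

variable {F : Type*} [Fintype F]

/-- The integer in `[0, q ^ M)` whose base `q` digits are the images under `φ` of the entries
of `v`. -/
def digitIndex (φ : F ≃ Fin (Fintype.card F)) {M : ℕ} (v : Fin M → F) : ℕ :=
  finFunctionFinEquiv (φ ∘ v)

theorem digitIndex_lt (φ : F ≃ Fin (Fintype.card F)) {M : ℕ} (v : Fin M → F) :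
    digitIndex φ v < Fintype.card F ^ M :=
  (finFunctionFinEquiv (φ ∘ v)).isLt

theorem digitIndex_injective (φ : F ≃ Fin (Fintype.card F)) (M : ℕ) :
    Function.Injective (digitIndex φ : (Fin M → F) → ℕ) := fun _ _ h =>
  φ.injective.comp_left (finFunctionFinEquiv.injective (Fin.ext h))

variable [Field F]

theorem baseDigit_digitIndex (φ : F ≃ Fin (Fintype.card F)) {M : ℕ} (v : Fin M → F) (k : Fin M) :
    baseDigit F (digitIndex φ v) k = φ (v k) := by
  have h := congrFun (finFunctionFinEquiv.symm_apply_apply (φ ∘ v)) k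
  exact h

theorem baseDigit_digitIndex_of_le (φ : F ≃ Fin (Fintype.card F)) (hφ : (φ 0 : ℕ) = 0) {M : ℕ}
    (v : Fin M → F) {k : ℕ} (hk : M ≤ k) : baseDigit F (digitIndex φ v) k = φ 0 := by
  apply Fin.ext
  have hlt : digitIndex φ v < Fintype.card F ^ k :=
    (digitIndex_lt φ v).trans_le (Nat.pow_le_pow_right Fintype.card_pos hk)
  rw [hφ, baseDigit, Fin.val_mk, Nat.div_eq_of_lt hlt, Nat.zero_mod]

theorem digitalVector_digitIndex (φ : F ≃ Fin (Fintype.card F)) (hφ : (φ 0 : ℕ) = 0)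
    (C : Matrix ℕ ℕ F) {M : ℕ} (v : Fin M → F) (i : ℕ) :
    digitalVector φ C (digitIndex φ v) i = ∑ k : Fin M, C i k * v k := by
  rw [digitalVector, finsum_eq_sum_of_support_subset (s := Finset.range M), Finset.sum_range]
  · simp only [baseDigit_digitIndex, Equiv.symm_apply_apply]
  · intro k hk
    rw [Finset.coe_range, Set.mem_Iio]
    by_contra! h
    exact hk (by simp only [baseDigit_digitIndex_of_le φ hφ v h, Equiv.symm_apply_apply, mul_zero])

theorem digitalSequence_eq_ofDigits {d : ℕ} (φ : F ≃ Fin (Fintype.card F))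
    (C : Fin d → Matrix ℕ ℕ F) (n : ℕ) (j : Fin d) :
    digitalSequence φ C n j = Real.ofDigits fun i => φ (digitalVector φ (C j) n i) :=
  tsum_congr fun _ => div_eq_mul_inv _ _

/-- The kernel has index equal to the size of the range, which is at most `q ^ d`. -/
theorem card_pow_le_card_ker_mul {M d : ℕ} (f : (Fin M → F) →ₗ[F] (Fin d → F)) :
    Fintype.card F ^ M ≤ Nat.card (LinearMap.ker f) * Fintype.card F ^ d := by
  have h := (LinearMap.ker f).card_eq_card_quotient_mul_card
  rw [Nat.card_congr f.quotKerEquivRange.toEquiv] at h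
  have hle : Nat.card (LinearMap.range f) ≤ Nat.card (Fin d → F) :=
    Nat.card_le_card_of_injective _ Subtype.val_injective
  simp only [Nat.card_eq_fintype_card (α := Fin _ → F), Fintype.card_fun, Fintype.card_fin] at h hle
  rw [h]
  gcongr

/-- `φ` need not be additive, so `hv` fixes the digit of `v` at `A` to be 0, and adding `u` turns it
into `φ 1`. The tail error `q ^ (-(A + T))` is written relative to `q ^ (-(A + 1))`. -/
theorem digitalSequence_sub_mem_Icc {d : ℕ} (φ : F ≃ Fin (Fintype.card F)) (hφ : (φ 0 : ℕ) = 0)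
    (C : Fin d → Matrix ℕ ℕ F) {M A T : ℕ} (hT : 0 < T) (u v : Fin M → F) (j : Fin d)
    (hu : ∀ i < A + T, ∑ k : Fin M, C j i k * u k = if i = A then 1 else 0)
    (hv : ∑ k : Fin M, C j A k * v k = 0) :
    (digitalSequence φ C (digitIndex φ (u + v)) - digitalSequence φ C (digitIndex φ v)) j ∈
      Set.Icc ((((φ 1 : ℕ) : ℝ) - (Fintype.card F : ℝ) / (Fintype.card F : ℝ) ^ T) /
          (Fintype.card F : ℝ) ^ (A + 1))
        ((((φ 1 : ℕ) : ℝ) + (Fintype.card F : ℝ) / (Fintype.card F : ℝ) ^ T) /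
          (Fintype.card F : ℝ) ^ (A + 1)) := by
  have hq : (Fintype.card F : ℝ) ≠ 0 := Nat.cast_ne_zero.2 Fintype.card_ne_zero
  have hadd : ∀ i, digitalVector φ (C j) (digitIndex φ (u + v)) i =
      ∑ k : Fin M, C j i k * u k + digitalVector φ (C j) (digitIndex φ v) i := fun i => by
    simp only [digitalVector_digitIndex φ hφ, Pi.add_apply, mul_add, Finset.sum_add_distrib]
  have h := Real.abs_ofDigits_sub_ofDigits_sub_le
    (x := fun i => φ (digitalVector φ (C j) (digitIndex φ (u + v)) i))
    (y := fun i => φ (digitalVector φ (C j) (digitIndex φ v) i))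
    (Nat.lt_add_of_pos_right (n := A) hT)
    (fun i hi hiA => by simp only [hadd, hu i hi, if_neg hiA, zero_add])
  rw [← digitalSequence_eq_ofDigits, ← digitalSequence_eq_ofDigits] at h
  simp only [hadd, hu A (by omega), if_true, digitalVector_digitIndex φ hφ (C j) v A, hv,
    add_zero, hφ, Nat.cast_zero, sub_zero] at h
  have hη : (Fintype.card F : ℝ) / (Fintype.card F : ℝ) ^ T / (Fintype.card F : ℝ) ^ (A + 1) =
      ((Fintype.card F : ℝ) ^ (A + T))⁻¹ := by
    rw [pow_succ]
    field_simp
    ring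
  rw [Pi.sub_apply, Set.mem_Icc, sub_div, add_div, hη]
  rw [abs_le] at h
  constructor <;> linarith

end Digital

/-! ### Many pairs near the distance `φ 1` -/

section Main

variable {F : Type*} [Field F] [Fintype F]

theorem digit_one_pos (φ : F ≃ Fin (Fintype.card F)) (hφ : (φ 0 : ℕ) = 0) : 0 < (φ 1 : ℕ) :=
  Nat.pos_of_ne_zero fun h => one_ne_zero (φ.injective (Fin.ext (h.trans hφ.symm)))

theorem exists_pairCount_digitalSequence_add_le (φ : F ≃ Fin (Fintype.card F))
    (hφ : (φ 0 : ℕ) = 0) {d : ℕ} (hd : 1 ≤ d) (Q : Fin d → F[X])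
    (hmonic : ∀ j, (Q j).Monic) (hnonconst : ∀ j, 0 < (Q j).natDegree)
    (hcoprime : ∀ i j, i ≠ j → IsCoprime (Q i) (Q j)) (C : Fin d → Matrix ℕ ℕ F)
    (hC : ∀ j, C j = niederreiterMatrix (Q j) ∨ C j = columnMatrix (Q j))
    {T : ℕ} (hT : 2 ≤ T) :
    ∃ N ≥ T, ∀ ε : ℝ, (Fintype.card F : ℝ) / (Fintype.card F : ℝ) ^ T < ε →
      (pairCount (digitalSequence φ C) ((φ 1 : ℕ) - ε) N : ℝ) / N +
        ((Fintype.card F : ℝ) ^ d)⁻¹ ≤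
      (pairCount (digitalSequence φ C) ((φ 1 : ℕ) + ε) N : ℝ) / N := by
  have hq : 2 ≤ Fintype.card F := Fintype.one_lt_card
  have hq' : (2 : ℝ) ≤ Fintype.card F := by exact_mod_cast hq
  have hq0 : (0 : ℝ) < Fintype.card F := by linarith
  obtain ⟨A, P, hTA, hP, hdeg, hPQ⟩ :=
    exists_monic_eq_pow_mul_one_add Q hmonic hnonconst hcoprime T
  -- Then `N = q ^ M` has `N ^ (1 / d) = q ^ (A + 1)`, the scale of digit `A`, and `M` exceeds the
  -- degree of `P`.
  set M := d * (A + 1) with hM_def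
  have hPM : P.natDegree < M := by
    rw [hdeg, hM_def, mul_add]
    omega
  let u : Fin M → F := fun k => P.coeff k
  have hu : ∀ j, ∀ i < A + T, ∑ k : Fin M, C j i k * u k = if i = A then 1 else 0 := by
    intro j i hi
    obtain ⟨S, w, hS, hPS⟩ := hPQ j
    have hi' : i < (Q j).natDegree * (S + T) := by
      rw [mul_add, hS]
      exact hi.trans_le (Nat.add_le_add_left (Nat.le_mul_of_pos_left _ (hnonconst j)) _)
    rw [← Finset.sum_range (fun k => C j i k * P.coeff k), ← hS, hPS]
    rw [hPS] at hPM
    rcases hC j with h | h <;> rw [h]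
    · exact niederreiterMatrix_row_pow_mul_one_add (hmonic j) (hnonconst j) w hi' hPM
    · exact columnMatrix_row_pow_mul_one_add (hmonic j) (hnonconst j) w (by omega) hi' hPM
  let f : (Fin M → F) →ₗ[F] (Fin d → F) := Matrix.mulVecLin (Matrix.of fun j (k : Fin M) => C j A k)
  have hf : ∀ v : LinearMap.ker f, ∀ j, ∑ k : Fin M, C j A k * v.1 k = 0 := fun v j =>
    congrFun (LinearMap.mem_ker.1 v.2) j
  have hu0 : u ≠ 0 := fun h => by
    have := hu ⟨0, hd⟩ A (by omega)
    simp [h] at this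
  have hNrpow : ((Fintype.card F ^ M : ℕ) : ℝ) ^ (1 / (d : ℝ)) = (Fintype.card F : ℝ) ^ (A + 1) := by
    rw [Nat.cast_pow, hM_def, mul_comm, pow_mul, one_div,
      Real.pow_rpow_inv_natCast (by positivity) (by omega)]
  have hqA : (0 : ℝ) < (Fintype.card F : ℝ) ^ (A + 1) := by positivity
  refine ⟨Fintype.card F ^ M, ?_, fun ε hε => ?_⟩
  · calc T ≤ A + 1 := by omega
      _ ≤ M := Nat.le_mul_of_pos_left _ hd
      _ ≤ Fintype.card F ^ M := (Nat.lt_pow_self hq).le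
  set η : ℝ := (Fintype.card F : ℝ) / (Fintype.card F : ℝ) ^ T with hη
  have hη0 : 0 < η := by positivity
  have hη1 : η ≤ 1 := by
    rw [hη, div_le_one (by positivity)]
    exact le_self_pow₀ (by linarith) (by omega)
  have hφ1 : (1 : ℝ) ≤ (φ 1 : ℕ) := by
    exact_mod_cast digit_one_pos φ hφ
  have hφq : ((φ 1 : ℕ) : ℝ) + 1 ≤ Fintype.card F := by exact_mod_cast (φ 1).isLt
  have hnorm : ∀ v : LinearMap.ker f,
      torusSupNorm (digitalSequence φ C (digitIndex φ (u + v.1)) -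
        digitalSequence φ C (digitIndex φ v.1)) ∈
      Set.Icc ((((φ 1 : ℕ) : ℝ) - η) / (Fintype.card F : ℝ) ^ (A + 1))
        ((((φ 1 : ℕ) : ℝ) + η) / (Fintype.card F : ℝ) ^ (A + 1)) := by
    intro v
    refine torusSupNorm_mem_Icc hd (div_nonneg (by linarith) hqA.le) ?_ fun j =>
      digitalSequence_sub_mem_Icc φ hφ C (by omega) u v.1 j (hu j) (hf v j)
    -- As `φ 1 + η ≤ q`, the upper end is at most `q ^ (-A) ≤ 1 / 4`, so no wrap-around occurs on
    -- the torus.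
    have h4 : (2 : ℝ) ^ 2 ≤ (Fintype.card F : ℝ) ^ A :=
      (pow_le_pow_left₀ (by norm_num) hq' 2).trans (pow_le_pow_right₀ (by linarith) (by omega))
    rw [div_lt_iff₀ hqA, pow_succ]
    nlinarith
  have hcount := pairCount_add_card_le (x := digitalSequence φ C) (N := Fintype.card F ^ M)
    (s₁ := (φ 1 : ℕ) - ε) (s₂ := (φ 1 : ℕ) + ε) (by linarith)
    (fun v : LinearMap.ker f => (digitIndex φ (u + v.1), digitIndex φ v.1))
    (fun v w h => Subtype.ext (digitIndex_injective φ M (Prod.ext_iff.1 h).2))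
    (fun v => ⟨digitIndex_lt φ _, digitIndex_lt φ _, fun h =>
      hu0 (add_eq_right.1 (digitIndex_injective φ M h))⟩)
    (fun v => by
      rw [hNrpow]
      exact (div_lt_div_of_pos_right (by linarith) hqA).trans_le (hnorm v).1)
    (fun v => by
      rw [hNrpow]
      exact (hnorm v).2.trans (div_le_div_of_nonneg_right (by linarith) hqA.le))
  have hker : (Fintype.card F : ℝ) ^ M ≤ Nat.card (LinearMap.ker f) * (Fintype.card F : ℝ) ^ d := by
    exact_mod_cast card_pow_le_card_ker_mul f
  have hqM : (0 : ℝ) < (Fintype.card F : ℝ) ^ M := by positivity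
  have hcount' : (pairCount (digitalSequence φ C) ((φ 1 : ℕ) - ε) (Fintype.card F ^ M) : ℝ) +
      Nat.card (LinearMap.ker f) ≤
      pairCount (digitalSequence φ C) ((φ 1 : ℕ) + ε) (Fintype.card F ^ M) := by
    exact_mod_cast hcount
  rw [Nat.cast_pow, div_add' _ _ _ hqM.ne', div_le_div_iff_of_pos_right hqM]
  refine le_trans ?_ hcount'
  gcongr
  rw [inv_mul_le_iff₀ (by positivity), mul_comm]
  exact hker

end Main

theorem theorem1 {F : Type*} [Field F] [Fintype F]
    (φ : F ≃ Fin (Fintype.card F)) (hφ : (φ 0 : ℕ) = 0)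
    {d : ℕ} (hd : 1 ≤ d)
    (Q : Fin d → Polynomial F)
    (hmonic : ∀ j, (Q j).Monic)
    (hnonconst : ∀ j, 0 < (Q j).natDegree)
    (hcoprime : ∀ i j, i ≠ j → IsCoprime (Q i) (Q j))
    (C : Fin d → Matrix ℕ ℕ F)
    (hC : ∀ j, C j = niederreiterMatrix (Q j) ∨ C j = columnMatrix (Q j)) :
    ¬ HasPoissonianPairCorrelations (digitalSequence φ C) := by
  have hq : (1 : ℝ) < Fintype.card F := by exact_mod_cast Fintype.one_lt_card (α := F)
  have hφ1 : (0 : ℝ) < (φ 1 : ℕ) := Nat.cast_pos.2 (digit_one_pos φ hφ)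
  refine not_hasPoissonianPairCorrelations_of_frequently hφ1
    (c := ((Fintype.card F : ℝ) ^ d)⁻¹) (by positivity) fun ε hε => ?_
  have hlim : Filter.Tendsto (fun T : ℕ => (Fintype.card F : ℝ) / (Fintype.card F : ℝ) ^ T)
      Filter.atTop (nhds 0) :=
    (tendsto_pow_atTop_atTop_of_one_lt hq).const_div_atTop _
  rw [Filter.frequently_atTop]
  intro a
  -- Large `T` narrows the window below `ε` and, through `T ≤ N`, makes `N` arbitrarily large.
  obtain ⟨T, hTε, hT⟩ := ((hlim.eventually (eventually_lt_nhds hε)).and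
    (Filter.eventually_ge_atTop (max 2 a))).exists
  obtain ⟨N, hN, h⟩ := exists_pairCount_digitalSequence_add_le φ hφ hd Q hmonic hnonconst hcoprime
    C hC (le_of_max_le_left hT)
  exact ⟨N, (le_of_max_le_right hT).trans hN, h ε hTε⟩
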